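/- Let $L^2(\mathbb{R}^3\times\mathbb{R}^3)$ be the space of complex-valued Hilbert--Schmidt kernels $k(x,y)$ on $\mathbb{R}^3$, with the Hilbert--Schmidt norm $\|k\|=\|k\|_{L^2(dx\,dy)}$; for two such kernels let $(kl)(x,y)=\int_{\mathbb{R}^3}k(x,z)\,l(z,y)\,dz$ denote their composition and $\overline{k}(x,y)=\overline{k(x,y)}$ the complex conjugate kernel. Let $\mathcal{S}$ be the set of symmetric kernels, i.e. those $k\in L^2(\mathbb{R}^3\times\mathbb{R}^3)$ with $k(x,y)=k(y,x)$ for almost every $(x,y)$, with the topology induced by the norm. For $k\in\mathcal{S}$ the series $$\mathrm{sh}(k)=\sum_{n=0}^{\infty}\frac{1}{(2n+1)!}\,(k\overline{k})^{n}k = k+\frac{1}{3!}\,k\overline{k}k+\cdots$$ converges in $L^2(\mathbb{R}^3\times\mathbb{R}^3)$, and the map $k\mapsto \mathrm{sh}(k)$ is a homeomorphism of $\mathcal{S}$ onto $\mathcal{S}$: it maps $\mathcal{S}$ to $\mathcal{S}$ and is one to one, onto, and continuous, with a continuous inverse. -/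

import Mathlib

open MeasureTheory
open scoped ENNReal Nat

noncomputable section

namespace PairExcitation

/-- Hilbert–Schmidt kernels over a measure space `(X, μ)`: the space `L²(X × X)` of complex-valued
kernels `k(x, y)`, with the `L²(dx dy)` (that is, Hilbert–Schmidt) norm. -/
abbrev HSKernel {X : Type*} [MeasurableSpace X] (μ : Measure X) : Type _ :=
  Lp ℂ 2 (μ.prod μ)

variable {X : Type*} [MeasurableSpace X] {μ : Measure X}

/-- The composition of two square integrable kernels is square integrable. -/
theorem memLp_comp [SFinite μ] (k l : HSKernel μ) :
    MemLp (fun p : X × X => ∫ z, k (p.1, z) * l (z, p.2) ∂μ) 2 (μ.prod μ) := by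
  have hk : StronglyMeasurable k := Lp.stronglyMeasurable k
  have hl : StronglyMeasurable l := Lp.stronglyMeasurable l
  have fin : ∀ f : HSKernel μ, ∫⁻ p, ‖f p‖ₑ ^ (2 : ℝ) ∂(μ.prod μ) < ∞ := fun f => by
    simpa using (eLpNorm_lt_top_iff_lintegral_rpow_enorm_lt_top
      (p := 2) (by norm_num) (by norm_num)).1 (Lp.memLp f).2
  have hk2 : Measurable fun p : X × X => ‖k p‖ₑ ^ (2 : ℝ) := hk.enorm.pow_const _
  have hl2 : Measurable fun p : X × X => ‖l p‖ₑ ^ (2 : ℝ) := hl.enorm.pow_const _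
  have hm : StronglyMeasurable fun p : X × X => ∫ z, k (p.1, z) * l (z, p.2) ∂μ := by
    apply StronglyMeasurable.integral_prod_right
      (f := fun (p : X × X) (z : X) => k (p.1, z) * l (z, p.2))
    exact (hk.comp_measurable (g := fun q : (X × X) × X => (q.1.1, q.2)) (by fun_prop)).mul
      (hl.comp_measurable (g := fun q : (X × X) × X => (q.2, q.1.2)) (by fun_prop))
  refine ⟨hm.aestronglyMeasurable, ?_⟩
  rw [eLpNorm_lt_top_iff_lintegral_rpow_enorm_lt_top (by norm_num) (by norm_num)]
  have bound : ∀ p : X × X, ‖∫ z, k (p.1, z) * l (z, p.2) ∂μ‖ₑ ^ (2 : ℝ) ≤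
      (∫⁻ z, ‖k (p.1, z)‖ₑ ^ (2 : ℝ) ∂μ) * ∫⁻ z, ‖l (z, p.2)‖ₑ ^ (2 : ℝ) ∂μ := fun p => by
    have h1 : ‖∫ z, k (p.1, z) * l (z, p.2) ∂μ‖ₑ ≤
        (∫⁻ z, ‖k (p.1, z)‖ₑ ^ (2 : ℝ) ∂μ) ^ (1 / (2 : ℝ)) *
          (∫⁻ z, ‖l (z, p.2)‖ₑ ^ (2 : ℝ) ∂μ) ^ (1 / (2 : ℝ)) := by
      refine (enorm_integral_le_lintegral_enorm _).trans ?_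
      simp only [enorm_mul]
      exact ENNReal.lintegral_mul_le_Lp_mul_Lq μ Real.HolderConjugate.two_two
        (hk.enorm.comp (by fun_prop : Measurable fun z : X => (p.1, z))).aemeasurable
        (hl.enorm.comp (by fun_prop : Measurable fun z : X => (z, p.2))).aemeasurable
    refine (ENNReal.rpow_le_rpow h1 (by norm_num)).trans_eq ?_
    rw [ENNReal.mul_rpow_of_nonneg _ _ (by norm_num), ← ENNReal.rpow_mul, ← ENNReal.rpow_mul]
    norm_num
  have hA : Measurable fun x : X => ∫⁻ z, ‖k (x, z)‖ₑ ^ (2 : ℝ) ∂μ := hk2.lintegral_prod_right'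
  have hB : Measurable fun y : X => ∫⁻ z, ‖l (z, y)‖ₑ ^ (2 : ℝ) ∂μ := hl2.lintegral_prod_left'
  have hfin : (∫⁻ x, ∫⁻ z, ‖k (x, z)‖ₑ ^ (2 : ℝ) ∂μ ∂μ) *
      (∫⁻ y, ∫⁻ z, ‖l (z, y)‖ₑ ^ (2 : ℝ) ∂μ ∂μ) < ∞ := by
    rw [← lintegral_prod _ hk2.aemeasurable, ← lintegral_prod_symm _ hl2.aemeasurable]
    exact ENNReal.mul_lt_top (fin k) (fin l)
  refine lt_of_le_of_lt (lintegral_mono fun p => ?_)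
    ((lintegral_prod_mul hA.aemeasurable hB.aemeasurable).trans_lt hfin)
  simpa using bound p

/-- Composition of kernels, `(k l)(x, y) = ∫ k(x, z) l(z, y) dz`. -/
def comp [SFinite μ] (k l : HSKernel μ) : HSKernel μ :=
  (memLp_comp k l).toLp _

/-- The kernel `(k k̄)ⁿ k`, where `k̄` (written `star k`) is the pointwise complex conjugate. -/
def oddPower [SFinite μ] (k : HSKernel μ) : ℕ → HSKernel μ
  | 0 => k
  | n + 1 => comp (comp k (star k)) (oddPower k n)

/-- The `n`-th term `(k k̄)ⁿ k / (2n+1)!` of the series of `sh(k)`. -/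
def shTerm [SFinite μ] (k : HSKernel μ) (n : ℕ) : HSKernel μ :=
  (((2 * n + 1)! : ℂ)⁻¹) • oddPower k n

/-- `sh(k) = k + (1/3!) k k̄ k + (1/5!) k k̄ k k̄ k + ⋯`, summed in `L²(dx dy)`. -/
def sh [SFinite μ] (k : HSKernel μ) : HSKernel μ :=
  ∑' n, shTerm k n

/-- The symmetric Hilbert–Schmidt kernels, `k(x, y) = k(y, x)` almost everywhere, as a subset of
`L²(X × X)`; used below with the induced (norm) topology. -/
def symmKernels (μ : Measure X) : Set (HSKernel μ) :=
  {k | ∀ᵐ p ∂(μ.prod μ), k (p.1, p.2) = k (p.2, p.1)}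

end PairExcitation

end

/-!
Associate to a symmetric kernel `k` the antilinear operator `K : f ↦ k f̄`. It is self-adjoint for
the real inner product `Re ⟨f, g⟩`, and the kernel of `K²ⁿ⁺¹` is `(k k̄)ⁿ k`, so `sh` is the
hyperbolic sine of `K`.

Odd powers of self-adjoint operators are monotone: if `L` and `R` denote left multiplication by `A`
and right multiplication by `B`, then `L B = R A`, so `A²ⁿ⁺¹ - B²ⁿ⁺¹` is the image of `A - B` under
`∑ Lⁱ R²ⁿ⁻ⁱ`, and for commuting symmetric `L`, `R` this sum is positive because
`2 ∑ aⁱ b²ⁿ⁻ⁱ = a²ⁿ + b²ⁿ + ∑ⱼ ((a + b) aʲ bⁿ⁻¹⁻ʲ)²`. The leading term `k` of the series then makes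
`sh` strongly monotone, `‖a - b‖² ≤ ⟨sh a - sh b, a - b⟩`. A locally Lipschitz strongly monotone
map of a Hilbert space expands distances up to a constant, so its range is closed; it is open
because near each point it is a small Lipschitz perturbation of a multiple of the identity. Hence
it is a homeomorphism.
-/

namespace PairExcitation

section StronglyMonotone

open Filter Topology
open scoped NNReal

/-- Strong monotonicity with constant `m` of a map of a real inner product space into itself. -/
def IsStronglyMonotone {V : Type*} [NormedAddCommGroup V] [InnerProductSpace ℝ V]
    (m : ℝ) (F : V → V) : Prop :=
  ∀ x y, m * ‖x - y‖ ^ 2 ≤ inner ℝ (F x - F y) (x - y)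

theorem isClosed_range_of_antilipschitz {α β : Type*} [PseudoEMetricSpace α] [CompleteSpace α]
    [EMetricSpace β] {f : α → β} {K : ℝ≥0} (hf : AntilipschitzWith K f) (hc : Continuous f) :
    IsClosed (Set.range f) := by
  refine isClosed_of_closure_subset fun y hy => ?_
  have : NeBot (comap f (𝓝 y)) := comap_neBot fun t ht => by
    obtain ⟨_, hxt, x, rfl⟩ := mem_closure_iff_nhds.1 hy t ht
    exact ⟨x, hxt⟩
  have hcauchy : Cauchy (comap f (𝓝 y)) := cauchy_nhds.comap hf.comap_uniformity_le
  obtain ⟨x, hx⟩ := CompleteSpace.complete hcauchy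
  exact ⟨x, tendsto_nhds_unique (hc.tendsto x |>.mono_left hx) tendsto_comap⟩

variable {V : Type*} [NormedAddCommGroup V] [InnerProductSpace ℝ V] {m : ℝ} {F : V → V}

namespace IsStronglyMonotone

theorem mul_norm_sub_le (hF : IsStronglyMonotone m F) (x y : V) :
    m * ‖x - y‖ ≤ ‖F x - F y‖ := by
  rcases (norm_nonneg (x - y)).eq_or_lt with h | h
  · rw [← h, mul_zero]
    exact norm_nonneg _
  · refine le_of_mul_le_mul_right ?_ h
    calc m * ‖x - y‖ * ‖x - y‖ = m * ‖x - y‖ ^ 2 := by ring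
      _ ≤ inner ℝ (F x - F y) (x - y) := hF x y
      _ ≤ ‖F x - F y‖ * ‖x - y‖ := real_inner_le_norm _ _

theorem antilipschitzWith (hm : 0 < m) (hF : IsStronglyMonotone m F) :
    AntilipschitzWith (Real.toNNReal m⁻¹) F := by
  refine AntilipschitzWith.of_le_mul_dist fun x y => ?_
  rw [Real.coe_toNNReal _ (inv_nonneg.2 hm.le), dist_eq_norm, dist_eq_norm,
    ← div_eq_inv_mul, le_div_iff₀' hm]
  exact hF.mul_norm_sub_le x y

theorem approximatesLinearOn (hF : IsStronglyMonotone m F) {K : ℝ≥0} {s : Set V}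
    (hK : LipschitzOnWith K F s) {κ : ℝ} (hκ : 0 ≤ κ) :
    ApproximatesLinearOn F (κ • ContinuousLinearMap.id ℝ V) s
      (√(κ ^ 2 - 2 * κ * m + K ^ 2)).toNNReal := by
  intro x hx y hy
  have hsq : ‖F x - F y - κ • (x - y)‖ ^ 2 ≤ (κ ^ 2 - 2 * κ * m + K ^ 2) * ‖x - y‖ ^ 2 :=
    calc ‖F x - F y - κ • (x - y)‖ ^ 2
        = ‖F x - F y‖ ^ 2 - 2 * κ * inner ℝ (F x - F y) (x - y) + κ ^ 2 * ‖x - y‖ ^ 2 := by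
          rw [norm_sub_sq_real, real_inner_smul_right, norm_smul, mul_pow, Real.norm_eq_abs,
            sq_abs]
          ring
      _ ≤ (K * ‖x - y‖) ^ 2 - 2 * κ * (m * ‖x - y‖ ^ 2) + κ ^ 2 * ‖x - y‖ ^ 2 := by
          gcongr
          · exact hK.norm_sub_le hx hy
          · exact hF x y
      _ = (κ ^ 2 - 2 * κ * m + K ^ 2) * ‖x - y‖ ^ 2 := by ring
  rw [Real.coe_toNNReal _ (Real.sqrt_nonneg _)]
  refine (Real.le_sqrt_of_sq_le hsq).trans_eq ?_
  rw [Real.sqrt_mul' _ (sq_nonneg _), Real.sqrt_sq (norm_nonneg _)]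

theorem isOpenMap [CompleteSpace V] (hm : 0 < m) (hF : IsStronglyMonotone m F)
    (hlip : LocallyLipschitz F) : IsOpenMap F := by
  refine isOpenMap_iff_nhds_le.2 fun x => ?_
  obtain ⟨K, s, hs, hK⟩ := hlip x
  obtain ⟨κ, hκ, hKκ⟩ : ∃ κ : ℝ≥0, 0 < κ ∧ (K : ℝ) ^ 2 < 2 * κ * m := by
    refine ⟨(K ^ 2 + 1) / ⟨m, hm.le⟩, div_pos (by positivity) hm, ?_⟩
    have : ((K ^ 2 + 1) / ⟨m, hm.le⟩ : ℝ≥0) * m = (K : ℝ) ^ 2 + 1 := div_mul_cancel₀ _ hm.ne'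
    rw [mul_assoc, this]
    linarith [sq_nonneg (K : ℝ)]
  let inv : ((κ : ℝ) • ContinuousLinearMap.id ℝ V).NonlinearRightInverse :=
    { toFun := fun y => (κ : ℝ)⁻¹ • y
      nnnorm := κ⁻¹
      bound' := fun y => by simp [norm_smul]
      right_inv' := fun y => smul_inv_smul₀ (NNReal.coe_ne_zero.2 hκ.ne') y }
  refine ((hF.approximatesLinearOn hK κ.coe_nonneg).map_nhds_eq inv hs (Or.inr ?_)).ge
  rw [inv_inv, Real.toNNReal_lt_iff_lt_coe (Real.sqrt_nonneg _),
    Real.sqrt_lt' (NNReal.coe_pos.2 hκ)]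
  linarith

theorem isHomeomorph [CompleteSpace V] (hm : 0 < m) (hF : IsStronglyMonotone m F)
    (hlip : LocallyLipschitz F) : IsHomeomorph F := by
  have hanti := hF.antilipschitzWith hm
  have hopen := hF.isOpenMap hm hlip
  have hrange : IsClopen (Set.range F) :=
    ⟨isClosed_range_of_antilipschitz hanti hlip.continuous, hopen.isOpen_range⟩
  have hsurj : Function.Surjective F :=
    Set.range_eq_univ.1 (hrange.eq_univ (Set.range_nonempty F))
  exact ⟨hlip.continuous, hopen, hanti.injective, hsurj⟩

end IsStronglyMonotone

end StronglyMonotone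

section GeomSum

open Finset

theorem add_le_two_mul_sum_of_nonneg {m : ℕ → ℝ} {n : ℕ}
    (h : ∀ j < n, 0 ≤ m (2 * j) + 2 * m (2 * j + 1) + m (2 * j + 2)) :
    m 0 + m (2 * n) ≤ 2 * ∑ i ∈ range (2 * n + 1), m i := by
  induction n with
  | zero => simp [two_mul]
  | succ n ih =>
    have hn := h n n.lt_succ_self
    have := ih fun j hj => h j (hj.trans n.lt_succ_self)
    rw [show 2 * (n + 1) = 2 * n + 2 by ring, sum_range_succ, sum_range_succ]
    linarith

theorem geom_sum₂_smul_sub {A M : Type*} [Ring A] [AddCommGroup M] [Module A M] {x y : A}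
    (hc : Commute x y) {u v : M} (huv : x • v = y • u) (n : ℕ) :
    (∑ i ∈ range (n + 1), x ^ i * y ^ (n - i)) • (u - v) = x ^ n • u - y ^ n • v := by
  set S := ∑ i ∈ range n, x ^ i * y ^ (n - 1 - i)
  have hSx : Commute x S := .sum_right _ _ _ fun i _ =>
    ((Commute.refl x).pow_right i).mul_right (hc.pow_right _)
  have hSy : Commute y S := .sum_right _ _ _ fun i _ =>
    (hc.symm.pow_right i).mul_right ((Commute.refl y).pow_right _)
  have hu : ∑ i ∈ range (n + 1), x ^ i * y ^ (n - i) = x ^ n + S * y := by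
    rw [hc.geom_sum₂_succ_eq, hSy.eq]
  have hv : ∑ i ∈ range (n + 1), x ^ i * y ^ (n - i) = y ^ n + S * x :=
    (hc.geom_sum₂_comm (n + 1)).trans <| by
      rw [Nat.add_sub_cancel, hc.symm.geom_sum₂_succ_eq, hc.symm.geom_sum₂_comm n, hSx.eq]
  rw [smul_sub]
  nth_rw 1 [hu]
  rw [hv, add_smul, add_smul, mul_smul, mul_smul, huv, add_sub_add_right_eq_sub]

theorem commute_add_pow_mul_pow {A : Type*} [Semiring A] {a b : A} (hc : Commute a b) (j k : ℕ) :
    Commute (a + b) (a ^ j * b ^ k) :=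
  (((Commute.refl a).pow_right j).mul_right (hc.pow_right k)).add_left
    ((hc.symm.pow_right j).mul_right ((Commute.refl b).pow_right k))

theorem sq_add_mul_pow_mul_pow {A : Type*} [Semiring A] {a b : A} (hc : Commute a b) (j k : ℕ) :
    ((a + b) * (a ^ j * b ^ k)) ^ 2 = a ^ (2 * j) * b ^ (2 * k + 2) +
      2 * (a ^ (2 * j + 1) * b ^ (2 * k + 1)) + a ^ (2 * j + 2) * b ^ (2 * k) := by
  rw [(commute_add_pow_mul_pow hc j k).mul_pow, (hc.pow_pow j k).mul_pow, hc.add_sq]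
  have h : b * a ^ (2 * j) = a ^ (2 * j) * b := hc.symm.pow_right _
  have h' : b ^ 2 * a ^ (2 * j) = a ^ (2 * j) * b ^ 2 := hc.symm.pow_pow _ _
  calc (a ^ 2 + 2 * a * b + b ^ 2) * ((a ^ j) ^ 2 * (b ^ k) ^ 2)
      = b ^ 2 * a ^ (2 * j) * b ^ (2 * k) + 2 * (a * (b * a ^ (2 * j)) * b ^ (2 * k)) +
          a ^ 2 * a ^ (2 * j) * b ^ (2 * k) := by
        rw [← pow_mul', ← pow_mul']
        noncomm_ring
    _ = _ := by
        rw [h, h']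
        simp only [pow_succ', pow_zero, mul_one, mul_assoc]

variable {𝕜 E : Type*} [RCLike 𝕜] [NormedAddCommGroup E] [InnerProductSpace 𝕜 E]

theorem isPositive_sq_of_isSymmetric {T : E →ₗ[𝕜] E} (hT : T.IsSymmetric) :
    (T ^ 2).IsPositive :=
  ⟨hT.pow 2, fun x => by
    rw [pow_two, Module.End.mul_apply, hT]
    exact inner_self_nonneg⟩

theorem isPositive_geom_sum₂ {L R : E →ₗ[𝕜] E} (hL : L.IsSymmetric) (hR : R.IsSymmetric)
    (hc : Commute L R) (n : ℕ) :
    (∑ i ∈ range (2 * n + 1), L ^ i * R ^ (2 * n - i)).IsPositive := by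
  refine ⟨LinearMap.isSymmetric_sum _ fun i _ =>
    (hL.pow i).mul_of_commute (hR.pow _) (hc.pow_pow _ _), fun x => ?_⟩
  let m (i : ℕ) : ℝ := RCLike.re (inner 𝕜 ((L ^ i * R ^ (2 * n - i)) x) x)
  have hm : ∀ j < n, 0 ≤ m (2 * j) + 2 * m (2 * j + 1) + m (2 * j + 2) := fun j hj => by
    obtain ⟨k, rfl⟩ := Nat.exists_eq_add_of_lt hj
    -- Expanding `0 ≤ ‖(L + R) Lʲ Rᵏ x‖²` gives the weighted sum of three consecutive moments.
    have hS : ((L + R) * (L ^ j * R ^ k)).IsSymmetric :=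
      (hL.add hR).mul_of_commute ((hL.pow j).mul_of_commute (hR.pow k) (hc.pow_pow j k))
        (commute_add_pow_mul_pow hc j k)
    have h := (isPositive_sq_of_isSymmetric hS).2 x
    rw [sq_add_mul_pow_mul_pow hc] at h
    simp only [m]
    rw [show 2 * (j + k + 1) - 2 * j = 2 * k + 2 by omega,
      show 2 * (j + k + 1) - (2 * j + 1) = 2 * k + 1 by omega,
      show 2 * (j + k + 1) - (2 * j + 2) = 2 * k by omega]
    simpa [two_mul (_ * _ : Module.End 𝕜 E), two_mul (_ : ℝ), inner_add_left] using h
  have h0 : 0 ≤ m 0 := by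
    simpa [m, pow_mul'] using (isPositive_sq_of_isSymmetric (hR.pow n)).2 x
  have hn : 0 ≤ m (2 * n) := by
    simpa [m, pow_mul'] using (isPositive_sq_of_isSymmetric (hL.pow n)).2 x
  have h := add_le_two_mul_sum_of_nonneg hm
  rw [LinearMap.sum_apply, sum_inner, map_sum]
  linarith

end GeomSum

section Slices

variable {X Y Z : Type*} [MeasurableSpace X] [MeasurableSpace Y] [MeasurableSpace Z]
  {μ : Measure X} {ν : Measure Y} {ρ : Measure Z}

theorem ae_prod_ae_of_ae_prod_left [SFinite ν] [SFinite ρ] {P : X × Y → Prop}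
    (h : ∀ᵐ q ∂(μ.prod ν), P q) : ∀ᵐ p ∂(μ.prod ρ), ∀ᵐ y ∂ν, P (p.1, y) :=
  Measure.quasiMeasurePreserving_fst.ae (Measure.ae_ae_of_ae_prod h)

theorem ae_ae_of_ae_prod_symm [SFinite μ] [SFinite ν] {P : X × Y → Prop}
    (h : ∀ᵐ q ∂(μ.prod ν), P q) : ∀ᵐ y ∂ν, ∀ᵐ x ∂μ, P (x, y) :=
  Measure.ae_ae_of_ae_prod (Measure.measurePreserving_swap.quasiMeasurePreserving.ae h)

theorem ae_prod_ae_of_ae_prod_right [SFinite μ] [SFinite ν] [SFinite ρ] {P : Y × Z → Prop}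
    (h : ∀ᵐ q ∂(ν.prod ρ), P q) : ∀ᵐ p ∂(μ.prod ρ), ∀ᵐ y ∂ν, P (y, p.2) :=
  Measure.quasiMeasurePreserving_snd.ae (ae_ae_of_ae_prod_symm h)

end Slices

section LintegralComp

variable {X Y Z : Type*} [MeasurableSpace X] [MeasurableSpace Y] [MeasurableSpace Z]
  {μ : Measure X} {ν : Measure Y} {ρ : Measure Z}

theorem eLpNorm_two_rpow_two {ε : Type*} [TopologicalSpace ε] [ContinuousENorm ε] (f : X → ε) :
    eLpNorm f 2 μ ^ (2 : ℝ) = ∫⁻ x, ‖f x‖ₑ ^ (2 : ℝ) ∂μ :=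
  eLpNorm_nnreal_pow_eq_lintegral (p := 2) two_ne_zero

theorem ae_lt_top_of_eLpNorm_two_lt_top {f : X → ℝ≥0∞} (hf : Measurable f)
    (h : eLpNorm f 2 μ < ∞) : ∀ᵐ x ∂μ, f x < ∞ := by
  have hsq := lintegral_rpow_enorm_lt_top_of_eLpNorm_lt_top two_ne_zero ENNReal.ofNat_ne_top h
  filter_upwards [ae_lt_top (hf.enorm.pow_const _) hsq.ne] with x hx
  exact (ENNReal.rpow_lt_top_iff_of_pos (by norm_num)).1 hx

theorem lintegral_mul_le_eLpNorm_two_mul_eLpNorm_two {f g : X → ℝ≥0∞} (hf : Measurable f)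
    (hg : Measurable g) : ∫⁻ x, f x * g x ∂μ ≤ eLpNorm f 2 μ * eLpNorm g 2 μ := by
  simpa [eLpNorm_eq_lintegral_rpow_enorm_toReal] using
    ENNReal.lintegral_mul_le_Lp_mul_Lq μ Real.HolderConjugate.two_two hf.aemeasurable
      hg.aemeasurable

/-- Composition of nonnegative kernels, `(x, z) ↦ ∫ f(x, y) g(y, z) dy`. It dominates the
composition of complex kernels, and being defined for all measurable kernels it carries the
integrability estimates. -/
noncomputable def lintegralComp (ν : Measure Y) (f : X × Y → ℝ≥0∞) (g : Y × Z → ℝ≥0∞)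
    (p : X × Z) : ℝ≥0∞ :=
  ∫⁻ y, f (p.1, y) * g (y, p.2) ∂ν

theorem measurable_lintegralComp [SFinite ν] {f : X × Y → ℝ≥0∞} {g : Y × Z → ℝ≥0∞}
    (hf : Measurable f) (hg : Measurable g) : Measurable (lintegralComp ν f g) :=
  Measurable.lintegral_prod_right' (f := fun q : (X × Z) × Y => f (q.1.1, q.2) * g (q.2, q.1.2))
    ((hf.comp (by fun_prop)).mul (hg.comp (by fun_prop)))

theorem eLpNorm_lintegralComp_le [SFinite μ] [SFinite ν] [SFinite ρ] {f : X × Y → ℝ≥0∞}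
    {g : Y × Z → ℝ≥0∞} (hf : Measurable f) (hg : Measurable g) :
    eLpNorm (lintegralComp ν f g) 2 (μ.prod ρ) ≤
      eLpNorm f 2 (μ.prod ν) * eLpNorm g 2 (ν.prod ρ) := by
  have hf2 : Measurable fun p => ‖f p‖ₑ ^ (2 : ℝ) := hf.enorm.pow_const _
  have hg2 : Measurable fun p => ‖g p‖ₑ ^ (2 : ℝ) := hg.enorm.pow_const _
  have hA : Measurable fun x => ∫⁻ y, ‖f (x, y)‖ₑ ^ (2 : ℝ) ∂ν := hf2.lintegral_prod_right'
  have hB : Measurable fun z => ∫⁻ y, ‖g (y, z)‖ₑ ^ (2 : ℝ) ∂ν := hg2.lintegral_prod_left'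
  rw [← ENNReal.rpow_le_rpow_iff (z := 2) (by norm_num),
    ENNReal.mul_rpow_of_nonneg _ _ (by norm_num)]
  simp only [eLpNorm_two_rpow_two]
  rw [lintegral_prod _ hf2.aemeasurable, lintegral_prod_symm _ hg2.aemeasurable,
    ← lintegral_prod_mul hA.aemeasurable hB.aemeasurable]
  refine lintegral_mono fun p => ?_
  simp only [← eLpNorm_two_rpow_two]
  rw [← ENNReal.mul_rpow_of_nonneg _ _ (by norm_num)]
  exact ENNReal.rpow_le_rpow (lintegral_mul_le_eLpNorm_two_mul_eLpNorm_two
    (hf.comp (by fun_prop)) (hg.comp (by fun_prop))) (by norm_num)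

theorem eLpNorm_lintegralComp_lt_top [SFinite μ] [SFinite ν] [SFinite ρ] {f : X × Y → ℝ≥0∞}
    {g : Y × Z → ℝ≥0∞} (hf : Measurable f) (hg : Measurable g) (hf2 : eLpNorm f 2 (μ.prod ν) < ∞)
    (hg2 : eLpNorm g 2 (ν.prod ρ) < ∞) : eLpNorm (lintegralComp ν f g) 2 (μ.prod ρ) < ∞ :=
  (eLpNorm_lintegralComp_le hf hg).trans_lt (ENNReal.mul_lt_top hf2 hg2)

end LintegralComp

section Conj

variable {X : Type*} [MeasurableSpace X] {μ : Measure X} {p : ℝ≥0∞}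

theorem conj_add (f g : Lp ℂ p μ) : star (f + g) = star f + star g := by
  refine Lp.ext ?_
  filter_upwards [Lp.coeFn_star (f + g), Lp.coeFn_add f g, Lp.coeFn_add (star f) (star g),
    Lp.coeFn_star f, Lp.coeFn_star g] with x h1 h2 h3 h4 h5
  rw [h1, Pi.star_apply, h2, h3, Pi.add_apply, Pi.add_apply, h4, h5, Pi.star_apply,
    Pi.star_apply, star_add]

theorem conj_smul (c : ℝ) (f : Lp ℂ p μ) : star (c • f) = c • star f := by
  refine Lp.ext ?_
  filter_upwards [Lp.coeFn_star (c • f), Lp.coeFn_smul c f, Lp.coeFn_smul c (star f),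
    Lp.coeFn_star f] with x h1 h2 h3 h4
  rw [h1, Pi.star_apply, h2, h3, Pi.smul_apply, Pi.smul_apply, h4, Pi.star_apply, star_smul,
    star_trivial]

/-- Pointwise complex conjugation on `Lᵖ` as a real linear map; its values are written `star f`,
in terms of the operation Mathlib provides. -/
noncomputable def conjLinearMap (p : ℝ≥0∞) (μ : Measure X) : Lp ℂ p μ →ₗ[ℝ] Lp ℂ p μ where
  toFun := star
  map_add' := conj_add
  map_smul' := conj_smul

theorem conj_zero : star (0 : Lp ℂ p μ) = 0 :=
  map_zero (conjLinearMap p μ)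

theorem conj_sub (f g : Lp ℂ p μ) : star (f - g) = star f - star g :=
  map_sub (conjLinearMap p μ) f g

theorem norm_conj (f : Lp ℂ p μ) : ‖star f‖ = ‖f‖ := by
  rw [Lp.norm_def, Lp.norm_def, eLpNorm_congr_ae (Lp.coeFn_star f), eLpNorm_star]

theorem inner_conj_conj (f g : Lp ℂ 2 μ) : inner ℝ (star f) (star g) = inner ℝ f g :=
  LinearIsometry.inner_map_map ⟨conjLinearMap 2 μ, norm_conj⟩ f g

end Conj

variable {X : Type*} [MeasurableSpace X] {μ : Measure X}

theorem measurable_enorm_coe (k : HSKernel μ) : Measurable fun p => ‖k p‖ₑ :=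
  (Lp.stronglyMeasurable k).enorm

theorem eLpNorm_enorm_coe_lt_top (k : HSKernel μ) : eLpNorm (‖k ·‖ₑ) 2 (μ.prod μ) < ∞ :=
  (eLpNorm_enorm k).trans_lt (Lp.eLpNorm_lt_top k)

variable [SFinite μ]

section Composition

theorem measurable_lintegralComp_enorm (k l : HSKernel μ) :
    Measurable (lintegralComp μ (‖k ·‖ₑ) (‖l ·‖ₑ)) :=
  measurable_lintegralComp (measurable_enorm_coe k) (measurable_enorm_coe l)

theorem eLpNorm_lintegralComp_enorm_lt_top (k l : HSKernel μ) :
    eLpNorm (lintegralComp μ (‖k ·‖ₑ) (‖l ·‖ₑ)) 2 (μ.prod μ) < ∞ :=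
  eLpNorm_lintegralComp_lt_top (measurable_enorm_coe k) (measurable_enorm_coe l)
    (eLpNorm_enorm_coe_lt_top k) (eLpNorm_enorm_coe_lt_top l)

theorem coeFn_comp (k l : HSKernel μ) :
    comp k l =ᵐ[μ.prod μ] fun p => ∫ z, k (p.1, z) * l (z, p.2) ∂μ :=
  (memLp_comp k l).coeFn_toLp

theorem ae_integrable_comp (k l : HSKernel μ) :
    ∀ᵐ p ∂(μ.prod μ), Integrable (fun z => k (p.1, z) * l (z, p.2)) μ := by
  filter_upwards [ae_lt_top_of_eLpNorm_two_lt_top (measurable_lintegralComp_enorm k l)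
    (eLpNorm_lintegralComp_enorm_lt_top k l)] with p hp
  refine ⟨(((Lp.stronglyMeasurable k).comp_measurable (by fun_prop)).mul
    ((Lp.stronglyMeasurable l).comp_measurable (by fun_prop))).aestronglyMeasurable, ?_⟩
  simpa only [HasFiniteIntegral, enorm_mul, lintegralComp] using hp

theorem norm_comp_le (k l : HSKernel μ) : ‖comp k l‖ ≤ ‖k‖ * ‖l‖ := by
  have hbound (p : X × X) : ‖∫ z, k (p.1, z) * l (z, p.2) ∂μ‖ₑ ≤
      ‖lintegralComp μ (‖k ·‖ₑ) (‖l ·‖ₑ) p‖ₑ := by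
    refine (enorm_integral_le_lintegral_enorm _).trans_eq ?_
    simp only [enorm_mul, lintegralComp, enorm_eq_self]
  have h : eLpNorm (comp k l) 2 (μ.prod μ) ≤ eLpNorm k 2 (μ.prod μ) * eLpNorm l 2 (μ.prod μ) :=
    calc eLpNorm (comp k l) 2 (μ.prod μ)
        = eLpNorm (fun p => ∫ z, k (p.1, z) * l (z, p.2) ∂μ) 2 (μ.prod μ) :=
          eLpNorm_congr_ae (coeFn_comp k l)
      _ ≤ eLpNorm (lintegralComp μ (‖k ·‖ₑ) (‖l ·‖ₑ)) 2 (μ.prod μ) :=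
          eLpNorm_mono_enorm hbound
      _ ≤ eLpNorm (‖k ·‖ₑ) 2 (μ.prod μ) * eLpNorm (‖l ·‖ₑ) 2 (μ.prod μ) :=
          eLpNorm_lintegralComp_le (measurable_enorm_coe k) (measurable_enorm_coe l)
      _ = eLpNorm k 2 (μ.prod μ) * eLpNorm l 2 (μ.prod μ) := by
          rw [eLpNorm_enorm, eLpNorm_enorm]
  simp only [Lp.norm_def, ← ENNReal.toReal_mul]
  exact ENNReal.toReal_mono (ENNReal.mul_ne_top (Lp.eLpNorm_ne_top k) (Lp.eLpNorm_ne_top l)) h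

theorem comp_add_left (k k' l : HSKernel μ) : comp (k + k') l = comp k l + comp k' l := by
  refine Lp.ext ?_
  filter_upwards [coeFn_comp (k + k') l, coeFn_comp k l, coeFn_comp k' l,
    Lp.coeFn_add (comp k l) (comp k' l), ae_prod_ae_of_ae_prod_left (Lp.coeFn_add k k'),
    ae_integrable_comp k l, ae_integrable_comp k' l] with p h1 h2 h3 h4 hadd hk hk'
  rw [h1, h4, Pi.add_apply, h2, h3, ← integral_add hk hk']
  refine integral_congr_ae ?_
  filter_upwards [hadd] with z hz
  rw [hz, Pi.add_apply, add_mul]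

theorem comp_add_right (k l l' : HSKernel μ) : comp k (l + l') = comp k l + comp k l' := by
  refine Lp.ext ?_
  filter_upwards [coeFn_comp k (l + l'), coeFn_comp k l, coeFn_comp k l',
    Lp.coeFn_add (comp k l) (comp k l'), ae_prod_ae_of_ae_prod_right (Lp.coeFn_add l l'),
    ae_integrable_comp k l, ae_integrable_comp k l'] with p h1 h2 h3 h4 hadd hl hl'
  rw [h1, h4, Pi.add_apply, h2, h3, ← integral_add hl hl']
  refine integral_congr_ae ?_
  filter_upwards [hadd] with z hz
  rw [hz, Pi.add_apply, mul_add]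

theorem comp_smul_left (c : ℝ) (k l : HSKernel μ) : comp (c • k) l = c • comp k l := by
  refine Lp.ext ?_
  filter_upwards [coeFn_comp (c • k) l, coeFn_comp k l, Lp.coeFn_smul c (comp k l),
    ae_prod_ae_of_ae_prod_left (Lp.coeFn_smul c k)] with p h1 h2 h3 hsmul
  rw [h1, h3, Pi.smul_apply, h2, ← integral_smul]
  refine integral_congr_ae ?_
  filter_upwards [hsmul] with z hz
  rw [hz, Pi.smul_apply, smul_mul_assoc]

theorem comp_smul_right (c : ℝ) (k l : HSKernel μ) : comp k (c • l) = c • comp k l := by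
  refine Lp.ext ?_
  filter_upwards [coeFn_comp k (c • l), coeFn_comp k l, Lp.coeFn_smul c (comp k l),
    ae_prod_ae_of_ae_prod_right (Lp.coeFn_smul c l)] with p h1 h2 h3 hsmul
  rw [h1, h3, Pi.smul_apply, h2, ← integral_smul]
  refine integral_congr_ae ?_
  filter_upwards [hsmul] with z hz
  rw [hz, Pi.smul_apply, mul_smul_comm]

/-- Composition of kernels as a real bilinear map. -/
noncomputable def compBilin (μ : Measure X) [SFinite μ] :
    HSKernel μ →ₗ[ℝ] HSKernel μ →ₗ[ℝ] HSKernel μ :=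
  LinearMap.mk₂ ℝ comp comp_add_left comp_smul_left comp_add_right comp_smul_right

theorem zero_comp (k : HSKernel μ) : comp 0 k = 0 :=
  (compBilin μ).map_zero₂ k

theorem comp_zero (k : HSKernel μ) : comp k 0 = 0 :=
  map_zero (compBilin μ k)

theorem sub_comp (k k' l : HSKernel μ) : comp (k - k') l = comp k l - comp k' l :=
  (compBilin μ).map_sub₂ k k' l

theorem comp_sub (k l l' : HSKernel μ) : comp k (l - l') = comp k l - comp k l' :=
  map_sub (compBilin μ k) l l'

theorem star_comp (k l : HSKernel μ) : star (comp k l) = comp (star k) (star l) := by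
  refine Lp.ext ?_
  filter_upwards [coeFn_comp (star k) (star l), coeFn_comp k l, Lp.coeFn_star (comp k l),
    ae_prod_ae_of_ae_prod_left (Lp.coeFn_star k),
    ae_prod_ae_of_ae_prod_right (Lp.coeFn_star l)] with p h1 h2 h3 hk hl
  rw [h1, h3, Pi.star_apply, h2, ← starRingEnd_apply, ← integral_conj]
  refine integral_congr_ae ?_
  filter_upwards [hk, hl] with z hkz hlz
  rw [hkz, hlz, map_mul, Pi.star_apply, Pi.star_apply, starRingEnd_apply, starRingEnd_apply]

theorem ae_integrable_comp_comp (k l m : HSKernel μ) :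
    ∀ᵐ p ∂(μ.prod μ), Integrable
      (fun q : X × X => k (p.1, q.2) * l (q.2, q.1) * m (q.1, p.2)) (μ.prod μ) := by
  have hkl := measurable_lintegralComp_enorm k l
  have hm := measurable_enorm_coe m
  filter_upwards [ae_lt_top_of_eLpNorm_two_lt_top (measurable_lintegralComp hkl hm)
    (eLpNorm_lintegralComp_lt_top hkl hm (eLpNorm_lintegralComp_enorm_lt_top k l)
      (eLpNorm_enorm_coe_lt_top m))] with p hp
  have hmeas : StronglyMeasurable
      fun q : X × X => k (p.1, q.2) * l (q.2, q.1) * m (q.1, p.2) :=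
    (((Lp.stronglyMeasurable k).comp_measurable (by fun_prop)).mul
      ((Lp.stronglyMeasurable l).comp_measurable (by fun_prop))).mul
      ((Lp.stronglyMeasurable m).comp_measurable (by fun_prop))
  refine ⟨hmeas.aestronglyMeasurable, ?_⟩
  rw [HasFiniteIntegral, lintegral_prod _ hmeas.enorm.aemeasurable]
  refine lt_of_eq_of_lt (lintegral_congr fun w => ?_) hp
  simp only [enorm_mul, lintegralComp]
  exact lintegral_mul_const _ (((measurable_enorm_coe k).comp (by fun_prop)).mul
    ((measurable_enorm_coe l).comp (by fun_prop)))

theorem comp_assoc (k l m : HSKernel μ) : comp (comp k l) m = comp k (comp l m) := by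
  refine Lp.ext ?_
  filter_upwards [coeFn_comp (comp k l) m, coeFn_comp k (comp l m),
    ae_prod_ae_of_ae_prod_left (coeFn_comp k l), ae_prod_ae_of_ae_prod_right (coeFn_comp l m),
    ae_integrable_comp_comp k l m] with p h1 h2 hkl hlm hint
  rw [h1, h2]
  calc ∫ w, comp k l (p.1, w) * m (w, p.2) ∂μ
      = ∫ w, ∫ z, k (p.1, z) * l (z, w) * m (w, p.2) ∂μ ∂μ := by
        refine integral_congr_ae ?_
        filter_upwards [hkl] with w hw
        rw [hw, integral_mul_const]
    _ = ∫ z, ∫ w, k (p.1, z) * l (z, w) * m (w, p.2) ∂μ ∂μ := integral_integral_swap hint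
    _ = ∫ z, k (p.1, z) * comp l m (z, p.2) ∂μ := by
        refine integral_congr_ae ?_
        filter_upwards [hlm] with z hz
        rw [hz, ← integral_const_mul]
        simp only [mul_assoc]

end Composition

section Adjoint

/-- The transposed kernel `k(y, x)`, as a real linear isometry. -/
noncomputable def transpose : HSKernel μ →ₗᵢ[ℝ] HSKernel μ :=
  Lp.compMeasurePreservingₗᵢ ℝ Prod.swap Measure.measurePreserving_swap

theorem coeFn_transpose (k : HSKernel μ) : transpose k =ᵐ[μ.prod μ] fun p => k (p.2, p.1) :=
  Lp.coeFn_compMeasurePreserving k Measure.measurePreserving_swap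

theorem mem_symmKernels_iff {k : HSKernel μ} : k ∈ symmKernels μ ↔ transpose k = k := by
  rw [Lp.ext_iff]
  constructor <;> intro h
  · filter_upwards [h, coeFn_transpose k] with p hk htr
    rw [htr, ← hk]
  · change ∀ᵐ p ∂(μ.prod μ), _
    filter_upwards [h, coeFn_transpose k] with p hk htr
    rw [← htr, hk]

theorem transpose_star (k : HSKernel μ) : transpose (star k) = star (transpose k) := by
  refine Lp.ext ?_
  filter_upwards [coeFn_transpose (star k), coeFn_transpose k, Lp.coeFn_star (transpose k),
    Measure.measurePreserving_swap.quasiMeasurePreserving.ae (Lp.coeFn_star k)] with p h1 h2 h3 h4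
  rw [h1, h3, Pi.star_apply, h2]
  exact h4

theorem transpose_comp (k l : HSKernel μ) :
    transpose (comp k l) = comp (transpose l) (transpose k) := by
  refine Lp.ext ?_
  filter_upwards [coeFn_transpose (comp k l),
    Measure.measurePreserving_swap.quasiMeasurePreserving.ae (coeFn_comp k l),
    coeFn_comp (transpose l) (transpose k), ae_prod_ae_of_ae_prod_left (coeFn_transpose l),
    ae_prod_ae_of_ae_prod_right (coeFn_transpose k)] with p h1 h2 h3 hl hk
  refine h1.trans (h2.trans (Eq.trans ?_ h3.symm))
  refine integral_congr_ae ?_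
  filter_upwards [hl, hk] with z hlz hkz
  rw [hlz, hkz, mul_comm]
  rfl

/-- The kernel of the adjoint operator, `conj k(y, x)`. -/
noncomputable def adj (k : HSKernel μ) : HSKernel μ := star (transpose k)

theorem coeFn_adj (k : HSKernel μ) : adj k =ᵐ[μ.prod μ] fun p => star (k (p.2, p.1)) := by
  filter_upwards [Lp.coeFn_star (transpose k), coeFn_transpose k] with p hstar htr
  rw [adj, hstar, Pi.star_apply, htr]

theorem transpose_adj (k : HSKernel μ) : transpose (adj k) = adj (transpose k) :=
  transpose_star _

theorem ae_integrable_inner_comp (a k l : HSKernel μ) :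
    ∀ᵐ w ∂μ, Integrable
      (fun q : X × X => inner ℝ (a q * k (q.2, w)) (l (q.1, w))) (μ.prod μ) := by
  have hak := measurable_lintegralComp_enorm a k
  have hmeas : Measurable fun p => lintegralComp μ (‖a ·‖ₑ) (‖k ·‖ₑ) p * ‖l p‖ₑ :=
    hak.mul (measurable_enorm_coe l)
  have hfin : ∫⁻ p, lintegralComp μ (‖a ·‖ₑ) (‖k ·‖ₑ) p * ‖l p‖ₑ ∂(μ.prod μ) < ∞ :=
    (lintegral_mul_le_eLpNorm_two_mul_eLpNorm_two hak (measurable_enorm_coe l)).trans_lt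
      (ENNReal.mul_lt_top (eLpNorm_lintegralComp_enorm_lt_top a k) (eLpNorm_enorm_coe_lt_top l))
  rw [lintegral_prod_symm _ hmeas.aemeasurable] at hfin
  filter_upwards [ae_lt_top hmeas.lintegral_prod_left' hfin.ne] with w hw
  have hsm : StronglyMeasurable
      fun q : X × X => inner ℝ (a q * k (q.2, w)) (l (q.1, w)) :=
    ((Lp.stronglyMeasurable a).mul
      ((Lp.stronglyMeasurable k).comp_measurable (by fun_prop))).inner
      ((Lp.stronglyMeasurable l).comp_measurable (by fun_prop))
  refine ⟨hsm.aestronglyMeasurable, ?_⟩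
  rw [HasFiniteIntegral, lintegral_prod _ hsm.enorm.aemeasurable]
  refine lt_of_le_of_lt (lintegral_mono fun x => ?_) hw
  refine (lintegral_mono fun z => ?_).trans_eq
    (lintegral_mul_const _ (((measurable_enorm_coe a).comp (by fun_prop)).mul
      ((measurable_enorm_coe k).comp (by fun_prop))))
  rw [← enorm_mul, ← enorm_mul, enorm_le_iff_norm_le, norm_mul _ (l _)]
  exact norm_inner_le_norm _ _

theorem real_inner_mul_left (u v w : ℂ) : inner ℝ (u * v) w = inner ℝ v (star u * w) := by
  rw [Complex.inner, Complex.inner, map_mul, starRingEnd_apply, starRingEnd_apply]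
  ring_nf

theorem inner_comp_left (a k l : HSKernel μ) :
    inner ℝ (comp a k) l = inner ℝ k (comp (adj a) l) := by
  rw [L2.inner_def, L2.inner_def, integral_prod_symm _ (L2.integrable_inner _ _),
    integral_prod_symm _ (L2.integrable_inner _ _)]
  refine integral_congr_ae ?_
  filter_upwards [ae_integrable_inner_comp a k l, ae_ae_of_ae_prod_symm (coeFn_comp a k),
    ae_ae_of_ae_prod_symm (coeFn_comp (adj a) l), ae_ae_of_ae_prod_symm (ae_integrable_comp a k),
    ae_ae_of_ae_prod_symm (ae_integrable_comp (adj a) l),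
    ae_ae_of_ae_prod_symm (ae_prod_ae_of_ae_prod_left (coeFn_adj a))]
    with w hint hak hal hintk hintl hadj
  calc ∫ x, inner ℝ (comp a k (x, w)) (l (x, w)) ∂μ
      = ∫ x, ∫ z, inner ℝ (a (x, z) * k (z, w)) (l (x, w)) ∂μ ∂μ := by
        refine integral_congr_ae ?_
        filter_upwards [hak, hintk] with x hx hintx
        rw [hx, real_inner_comm, ← integral_inner hintx]
        simp only [real_inner_comm]
    _ = ∫ z, ∫ x, inner ℝ (a (x, z) * k (z, w)) (l (x, w)) ∂μ ∂μ := integral_integral_swap hint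
    _ = ∫ z, inner ℝ (k (z, w)) (comp (adj a) l (z, w)) ∂μ := by
        refine integral_congr_ae ?_
        filter_upwards [hal, hintl, hadj] with z hz hintz hadjz
        rw [hz, ← integral_inner hintz]
        refine integral_congr_ae ?_
        filter_upwards [hadjz] with x hx
        rw [hx, real_inner_mul_left]

theorem inner_comp_right (b k l : HSKernel μ) :
    inner ℝ (comp k b) l = inner ℝ k (comp l (adj b)) := by
  rw [← transpose.inner_map_map, transpose_comp, inner_comp_left, ← transpose.inner_map_map k,
    transpose_comp, transpose_adj]

end Adjoint

section Pairs

/-- Left multiplication by the antilinear operator `A : f ↦ a f̄` on the sum of the spaces of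
antilinear and of linear operators, which `A` exchanges. The pair `p` consists of the kernel of
`f ↦ p.fst f̄` and the kernel of `f ↦ p.snd f`. -/
noncomputable def leftOp (a : HSKernel μ) : Module.End ℝ (WithLp 2 (HSKernel μ × HSKernel μ)) where
  toFun p := WithLp.toLp 2 (comp a (star p.snd), comp a (star p.fst))
  map_add' p q := by
    simp only [WithLp.add_fst, WithLp.add_snd, conj_add, comp_add_right, ← WithLp.toLp_add,
      Prod.mk_add_mk]
  map_smul' c p := by
    simp only [WithLp.smul_fst, WithLp.smul_snd, conj_smul, comp_smul_right, ← WithLp.toLp_smul,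
      Prod.smul_mk, RingHom.id_apply]

/-- Right multiplication by the antilinear operator `f ↦ b f̄`, with pairs of kernels encoding
antilinear and linear operators as for `leftOp`. -/
noncomputable def rightOp (b : HSKernel μ) :
    Module.End ℝ (WithLp 2 (HSKernel μ × HSKernel μ)) where
  toFun p := WithLp.toLp 2 (comp p.snd b, comp p.fst (star b))
  map_add' p q := by
    simp only [WithLp.add_fst, WithLp.add_snd, comp_add_left, ← WithLp.toLp_add, Prod.mk_add_mk]
  map_smul' c p := by
    simp only [WithLp.smul_fst, WithLp.smul_snd, comp_smul_left, ← WithLp.toLp_smul,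
      Prod.smul_mk, RingHom.id_apply]

theorem leftOp_apply (a : HSKernel μ) (p : WithLp 2 (HSKernel μ × HSKernel μ)) :
    leftOp a p = WithLp.toLp 2 (comp a (star p.snd), comp a (star p.fst)) := rfl

theorem rightOp_apply (b : HSKernel μ) (p : WithLp 2 (HSKernel μ × HSKernel μ)) :
    rightOp b p = WithLp.toLp 2 (comp p.snd b, comp p.fst (star b)) := rfl

theorem commute_leftOp_rightOp (a b : HSKernel μ) : Commute (leftOp a) (rightOp b) := by
  refine LinearMap.ext fun p => ?_
  simp only [Module.End.mul_apply, leftOp_apply, rightOp_apply, WithLp.toLp_fst, WithLp.toLp_snd,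
    star_comp, star_star, comp_assoc]

theorem inner_comp_star_left {a : HSKernel μ} (ha : transpose a = a) (k l : HSKernel μ) :
    inner ℝ (comp a (star k)) l = inner ℝ k (comp a (star l)) := by
  rw [inner_comp_left, adj, ha, ← inner_conj_conj, star_star, star_comp, star_star]

theorem isSymmetric_leftOp {a : HSKernel μ} (ha : transpose a = a) : (leftOp a).IsSymmetric := by
  intro p q
  simp only [leftOp_apply, WithLp.prod_inner_apply, inner_comp_star_left ha]
  exact add_comm _ _

theorem isSymmetric_rightOp {b : HSKernel μ} (hb : transpose b = b) :
    (rightOp b).IsSymmetric := by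
  intro p q
  simp only [rightOp_apply, WithLp.prod_inner_apply, inner_comp_right, adj, transpose_star, hb,
    star_star]
  exact add_comm _ _

end Pairs

section OddPower

theorem oddPower_succ (k : HSKernel μ) (n : ℕ) :
    oddPower k (n + 1) = comp (comp k (star k)) (oddPower k n) := rfl

theorem oddPower_succ' (k : HSKernel μ) (n : ℕ) :
    oddPower k (n + 1) = comp (oddPower k n) (comp (star k) k) := by
  induction n with
  | zero => exact comp_assoc _ _ _
  | succ n ih => rw [oddPower_succ, ih, ← comp_assoc, ← oddPower_succ, ih]

theorem transpose_oddPower {k : HSKernel μ} (hk : transpose k = k) (n : ℕ) :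
    transpose (oddPower k n) = oddPower k n := by
  induction n with
  | zero => exact hk
  | succ n ih =>
    rw [oddPower_succ, transpose_comp, transpose_comp, transpose_star, hk, ih, ← oddPower_succ',
      oddPower_succ]

theorem leftOp_pow_apply (a : HSKernel μ) (n : ℕ) :
    (leftOp a ^ (2 * n)) (WithLp.toLp 2 (a, 0)) = WithLp.toLp 2 (oddPower a n, 0) := by
  induction n with
  | zero => rfl
  | succ n ih =>
    rw [mul_add_one, add_comm, pow_add, Module.End.mul_apply, ih, pow_two, Module.End.mul_apply]
    simp only [leftOp_apply, WithLp.toLp_fst, WithLp.toLp_snd, star_comp, star_star, conj_zero,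
      comp_zero, oddPower_succ, comp_assoc]

theorem rightOp_pow_apply (b : HSKernel μ) (n : ℕ) :
    (rightOp b ^ (2 * n)) (WithLp.toLp 2 (b, 0)) = WithLp.toLp 2 (oddPower b n, 0) := by
  induction n with
  | zero => rfl
  | succ n ih =>
    rw [mul_add_one, add_comm, pow_add, Module.End.mul_apply, ih, pow_two, Module.End.mul_apply]
    simp only [rightOp_apply, WithLp.toLp_fst, WithLp.toLp_snd, zero_comp, oddPower_succ',
      comp_assoc]

theorem inner_oddPower_sub_nonneg {a b : HSKernel μ} (ha : transpose a = a)
    (hb : transpose b = b) (n : ℕ) : 0 ≤ inner ℝ (oddPower a n - oddPower b n) (a - b) := by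
  have hc := commute_leftOp_rightOp a b
  have hab : leftOp a (WithLp.toLp 2 (b, 0)) = rightOp b (WithLp.toLp 2 (a, 0)) := by
    simp only [leftOp_apply, rightOp_apply, WithLp.toLp_fst, WithLp.toLp_snd, conj_zero,
      comp_zero, zero_comp]
  have htelescope := geom_sum₂_smul_sub hc hab (2 * n)
  rw [Module.End.smul_def, Module.End.smul_def, Module.End.smul_def, leftOp_pow_apply,
    rightOp_pow_apply] at htelescope
  have h := (isPositive_geom_sum₂ (isSymmetric_leftOp ha) (isSymmetric_rightOp hb) hc n).2
    (WithLp.toLp 2 (a, 0) - WithLp.toLp 2 (b, 0))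
  rw [htelescope] at h
  simpa [WithLp.prod_inner_apply] using h

theorem norm_comp_comp_le {A B C : ℝ} {k l m : HSKernel μ} (hk : ‖k‖ ≤ A) (hl : ‖l‖ ≤ B)
    (hm : ‖m‖ ≤ C) : ‖comp (comp k l) m‖ ≤ A * B * C := by
  have hA : 0 ≤ A := (norm_nonneg k).trans hk
  have hB : 0 ≤ B := (norm_nonneg l).trans hl
  calc ‖comp (comp k l) m‖ ≤ ‖comp k l‖ * ‖m‖ := norm_comp_le _ _
    _ ≤ ‖k‖ * ‖l‖ * ‖m‖ := by gcongr; exact norm_comp_le _ _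
    _ ≤ A * B * C := by gcongr

theorem norm_oddPower_le {M : ℝ} {k : HSKernel μ} (hk : ‖k‖ ≤ M) (n : ℕ) :
    ‖oddPower k n‖ ≤ M ^ (2 * n + 1) := by
  induction n with
  | zero => simpa [oddPower] using hk
  | succ n ih =>
    exact (norm_comp_comp_le hk ((norm_conj k).trans_le hk) ih).trans_eq (by ring)

theorem norm_oddPower_sub_le {M : ℝ} {k l : HSKernel μ} (hk : ‖k‖ ≤ M) (hl : ‖l‖ ≤ M) (n : ℕ) :
    ‖oddPower k n - oddPower l n‖ ≤ (2 * n + 1) * M ^ (2 * n) * ‖k - l‖ := by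
  induction n with
  | zero => simp [oddPower]
  | succ n ih =>
    have hk' : ‖star k‖ ≤ M := (norm_conj k).trans_le hk
    have hkl' : ‖star (k - l)‖ ≤ ‖k - l‖ := (norm_conj _).le
    have hln := norm_oddPower_le hl n
    calc ‖oddPower k (n + 1) - oddPower l (n + 1)‖
        = ‖comp (comp k (star k)) (oddPower k n - oddPower l n) +
            comp (comp (k - l) (star k)) (oddPower l n) +
            comp (comp l (star (k - l))) (oddPower l n)‖ := by
          simp only [oddPower_succ, conj_sub, sub_comp, comp_sub]
          abel_nf
      _ ≤ M * M * ((2 * n + 1) * M ^ (2 * n) * ‖k - l‖) + ‖k - l‖ * M * M ^ (2 * n + 1) +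
            M * ‖k - l‖ * M ^ (2 * n + 1) :=
          norm_add₃_le.trans (add_le_add_three (norm_comp_comp_le hk hk' ih)
            (norm_comp_comp_le le_rfl hk' hln) (norm_comp_comp_le hl hkl' hln))
      _ = (2 * ↑(n + 1) + 1) * M ^ (2 * (n + 1)) * ‖k - l‖ := by
          push_cast
          ring

end OddPower

section Sh

theorem shTerm_eq (k : HSKernel μ) (n : ℕ) :
    shTerm k n = ((2 * n + 1)! : ℝ)⁻¹ • oddPower k n := by
  rw [shTerm, RCLike.real_smul_eq_coe_smul (K := ℂ)]
  simp only [Complex.coe_algebraMap, Complex.ofReal_inv, Complex.ofReal_natCast]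

theorem hasSum_shTerm (k : HSKernel μ) : HasSum (shTerm k) (sh k) := by
  refine (Summable.of_norm_bounded (Real.hasSum_sinh ‖k‖).summable fun n => ?_).hasSum
  rw [shTerm_eq, norm_smul, norm_inv, Real.norm_natCast, div_eq_inv_mul]
  gcongr
  exact norm_oddPower_le le_rfl n

theorem transpose_sh {k : HSKernel μ} (hk : transpose k = k) : transpose (sh k) = sh k := by
  have hterm (n : ℕ) : transpose (shTerm k n) = shTerm k n := by
    rw [shTerm_eq, map_smul, transpose_oddPower hk]
  refine ((hasSum_shTerm k).mapL transpose.toContinuousLinearMap).unique ?_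
  simpa only [LinearIsometry.coe_toContinuousLinearMap, hterm] using hasSum_shTerm k

theorem sq_norm_sub_le_inner_sh_sub {a b : HSKernel μ} (ha : transpose a = a)
    (hb : transpose b = b) : ‖a - b‖ ^ 2 ≤ inner ℝ (sh a - sh b) (a - b) := by
  have hsum : HasSum (fun n => ((2 * n + 1)! : ℝ)⁻¹ *
      inner ℝ (oddPower a n - oddPower b n) (a - b)) (inner ℝ (sh a - sh b) (a - b)) := by
    have h := ((hasSum_shTerm a).sub (hasSum_shTerm b)).mapL (innerSL ℝ (a - b))
    simpa only [innerSL_apply_apply, shTerm_eq, ← smul_sub, real_inner_smul_right,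
      real_inner_comm (a - b)] using h
  calc ‖a - b‖ ^ 2 = ((2 * 0 + 1)! : ℝ)⁻¹ * inner ℝ (oddPower a 0 - oddPower b 0) (a - b) := by
        simp [oddPower]
    _ ≤ inner ℝ (sh a - sh b) (a - b) := le_hasSum hsum 0 fun n _ =>
        mul_nonneg (by positivity) (inner_oddPower_sub_nonneg ha hb n)

theorem norm_sh_sub_le {M : ℝ} {k l : HSKernel μ} (hk : ‖k‖ ≤ M) (hl : ‖l‖ ≤ M) :
    ‖sh k - sh l‖ ≤ Real.cosh M * ‖k - l‖ := by
  rw [← ((hasSum_shTerm k).sub (hasSum_shTerm l)).tsum_eq]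
  refine tsum_of_norm_bounded ((Real.hasSum_cosh M).mul_right ‖k - l‖) fun n => ?_
  calc ‖shTerm k n - shTerm l n‖
      = ((2 * n + 1)! : ℝ)⁻¹ * ‖oddPower k n - oddPower l n‖ := by
        rw [shTerm_eq, shTerm_eq, ← smul_sub, norm_smul, norm_inv, Real.norm_natCast]
    _ ≤ ((2 * n + 1)! : ℝ)⁻¹ * ((2 * n + 1) * M ^ (2 * n) * ‖k - l‖) := by
        gcongr
        exact norm_oddPower_sub_le hk hl n
    _ = M ^ (2 * n) / (2 * n)! * ‖k - l‖ := by
        rw [Nat.factorial_succ]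
        push_cast
        field_simp

theorem locallyLipschitz_sh : LocallyLipschitz (sh : HSKernel μ → HSKernel μ) := by
  intro k
  refine ⟨(Real.cosh (‖k‖ + 1)).toNNReal, Metric.ball k 1, Metric.ball_mem_nhds k one_pos,
    LipschitzOnWith.of_dist_le_mul fun l hl l' hl' => ?_⟩
  have hnorm {l : HSKernel μ} (hl : l ∈ Metric.ball k 1) : ‖l‖ ≤ ‖k‖ + 1 :=
    norm_le_of_mem_closedBall (Metric.ball_subset_closedBall hl)
  rw [Real.coe_toNNReal _ (Real.cosh_pos _).le, dist_eq_norm, dist_eq_norm]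
  exact norm_sh_sub_le (hnorm hl) (hnorm hl')

end Sh

section SymmetricKernels

/-- The symmetric kernels as a real subspace of `L²(X × X)`, so that they form a real Hilbert
space; the carrier is the set `symmKernels μ` itself. -/
noncomputable def symmSubmodule (μ : Measure X) [SFinite μ] : Submodule ℝ (HSKernel μ) :=
  (LinearMap.eqLocus transpose.toLinearMap LinearMap.id).copy (symmKernels μ)
    (Set.ext fun _ => mem_symmKernels_iff)

theorem isClosed_symmKernels (μ : Measure X) [SFinite μ] : IsClosed (symmKernels μ) := by
  have h : symmKernels μ = {k | transpose k = k} := Set.ext fun _ => mem_symmKernels_iff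
  rw [h]
  exact isClosed_eq transpose.continuous continuous_id

theorem mapsTo_sh_symmKernels : Set.MapsTo sh (symmKernels μ) (symmKernels μ) := fun _ hk =>
  mem_symmKernels_iff.2 (transpose_sh (mem_symmKernels_iff.1 hk))

theorem isHomeomorph_restrict_sh :
    IsHomeomorph (mapsTo_sh_symmKernels.restrict sh (symmKernels μ) (symmKernels μ)) := by
  have : CompleteSpace (symmSubmodule μ) := (isClosed_symmKernels μ).completeSpace_coe
  let F : symmSubmodule μ → symmSubmodule μ := mapsTo_sh_symmKernels.restrict sh _ _
  have hmono : IsStronglyMonotone 1 F := fun k l => (one_mul _).trans_le <|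
    sq_norm_sub_le_inner_sh_sub (mem_symmKernels_iff.1 k.2) (mem_symmKernels_iff.1 l.2)
  have hlip : LocallyLipschitz F := locallyLipschitz_sh.locallyLipschitzOn.restrict
  exact hmono.isHomeomorph one_pos hlip

end SymmetricKernels

end PairExcitation

theorem mainTheorem7_general {X : Type*} [MeasurableSpace X] (μ : Measure X) [SFinite μ] :
    (∀ k : PairExcitation.HSKernel μ, HasSum (PairExcitation.shTerm k) (PairExcitation.sh k)) ∧
      ∃ Φ : PairExcitation.symmKernels μ ≃ₜ PairExcitation.symmKernels μ,
        ∀ k, (Φ k : PairExcitation.HSKernel μ) = PairExcitation.sh k :=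
  ⟨PairExcitation.hasSum_shTerm, PairExcitation.isHomeomorph_restrict_sh.homeomorph, fun _ => rfl⟩

theorem mainTheorem7 :
    (∀ k ∈ PairExcitation.symmKernels (volume : Measure (EuclideanSpace ℝ (Fin 3))),
      HasSum (PairExcitation.shTerm k) (PairExcitation.sh k)) ∧
    ∃ Φ : PairExcitation.symmKernels (volume : Measure (EuclideanSpace ℝ (Fin 3))) ≃ₜ
        PairExcitation.symmKernels (volume : Measure (EuclideanSpace ℝ (Fin 3))),
      ∀ k : PairExcitation.symmKernels (volume : Measure (EuclideanSpace ℝ (Fin 3))),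
        (Φ k : PairExcitation.HSKernel (volume : Measure (EuclideanSpace ℝ (Fin 3)))) =
          PairExcitation.sh (k : PairExcitation.HSKernel volume) :=
  (mainTheorem7_general volume).imp_left fun h k _ => h k
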